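/- All relational structures below are finite and share a finite relational signature $\sigma$ whose symbols $R$ have arities $\mathrm{ar}(R)\ge 1$; $\mathbf X\to\mathbf Y$ means that there is a homomorphism from $\mathbf X$ to $\mathbf Y$ (a map of the domains preserving all relations). $\mathbb H$ denotes a nonzero finite-dimensional real or complex Hilbert space. **Quantum homomorphisms.** $\mathbf X$ and $\mathbf Y$ (with domains $X$, $Y$) are *quantum homomorphic over* $\mathbb H$ if there are orthogonal projectors $p_{x,y}$ of $\mathbb H$ ($x\in X$, $y\in Y$) such that (Q1) $\sum_{y\in Y}p_{x,y}=\mathrm{id}_{\mathbb H}$ for each $x\in X$; (Q2) for each $R\in\sigma$ and each $(x_1,\dots,x_r)\in R^{\mathbf X}$, the projectors $p_{x_i,y}$ and $p_{x_j,y'}$ commute for all $i,j\in\{1,\dots,r\}$ and $y,y'\in Y$; (Q3) $p_{x_1,y_1}p_{x_2,y_2}\cdots p_{x_r,y_r}=0$ for each $R\in\sigma$, $(x_1,\dots,x_r)\in R^{\mathbf X}$ and $(y_1,\dots,y_r)\in Y^r\setminus R^{\mathbf Y}$. If $\mathbf Y\to\mathbf Y'$, the pair $(\mathbf Y,\mathbf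 Y')$ *has quantum advantage over* $\mathbb H$ if there is a finite $\sigma$-structure $\mathbf X$ such that $\mathbf X$ and $\mathbf Y$ are quantum homomorphic over $\mathbb H$ but $\mathbf X\not\to\mathbf Y'$. **Minions.** A *minion* $\mathscr M$ consists of non-empty sets $\mathscr M^{(\ell)}$ for integers $\ell\ge 1$ and maps $M\mapsto M_{/\pi}$ from $\mathscr M^{(\ell)}$ to $\mathscr M^{(\ell')}$ for all $\pi:[\ell]\to[\ell']$, where $[\ell]=\{1,\dots,\ell\}$, such that $M_{/\mathrm{id}}=M$ and $(M_{/\pi})_{/\rho}=M_{/\rho\circ\pi}$. A *minion homomorphism* is a family of maps $\xi:\mathscr M^{(\ell)}\to\mathscr N^{(\ell)}$, $\ell\ge 1$, with $\xi(M_{/\pi})=\xi(M)_{/\pi}$; $\mathscr M\to\mathscr N$ means that one exists. Three minions are used: * $\mathrm{Pol}(\mathbf Y,\mathbf Y')$ (for $\mathbf Y\to\mathbf Y'$): the elements of arity $\ell$ are the homomorphisms $f:\mathbf Y^\ell\to\mathbf Y'$ from the $\ell$-th direct power of $\mathbf Y$, and $f_{/\pi}(s_1,\dots,s_{\ell'})=f(s_{\pi(1)},\dots,s_{\pi(\ell)})$.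 * The dictator minion $\mathscr D$: the elements of arity $\ell$ are the standard unit vectors of $\mathbb R^\ell$. * The minion $\mathscr S$: the elements of arity $\ell$ are the real matrices $M$ with $\ell$ rows and any finite number of columns such that $MM^\top$ is diagonal of trace $1$. In $\mathscr D$ and $\mathscr S$, the $i$-th entry (respectively row) of $M_{/\pi}$ is the sum of the entries (rows) of $M$ with index in $\pi^{-1}(i)$. **Statement.** Let $\mathbf Y\to\mathbf Y'$ be finite $\sigma$-structures. 1. For every $\mathbb H$ with $\dim\mathbb H\le 2$, $(\mathbf Y,\mathbf Y')$ has no quantum advantage over $\mathbb H$. 2. For every $\mathbb H$ with $\dim\mathbb H\ge 3$, if $\mathrm{Pol}(\mathbf Y,\mathbf Y')\to\mathscr D$, then $(\mathbf Y,\mathbf Y')$ has quantum advantage over $\mathbb H$. 3. If $\mathscr S\to\mathrm{Pol}(\mathbf Y,\mathbf Y')$, then $(\mathbf Y,\mathbf Y')$ has no quantum advantage over any $\mathbb H$. -/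

import Mathlib

/-! Relational structures are Mathlib's first-order structures over a relational language; their
homomorphisms are Mathlib's `X →[L] Y`. -/

open scoped FirstOrder

namespace QuantumPCSP

open FirstOrder FirstOrder.Language

section Power

variable {L : Language}

/-- The domain `Y ^ ℓ` of the `ℓ`-th direct power of the structure `Y`. -/
def DirectPower (Y : Type*) (ℓ : ℕ) : Type _ := Fin ℓ → Y

/-- The direct power: a tuple of elements of `Y ^ ℓ` is in a relation iff each of its `ℓ` coordinate
tuples is in that relation of `Y`. -/
instance directPowerStructure (Y : Type*) [L.Structure Y] (ℓ : ℕ) :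
    L.Structure (DirectPower Y ℓ) where
  funMap f x := fun i => Structure.funMap f fun j => x j i
  RelMap R x := ∀ i : Fin ℓ, Structure.RelMap R fun j => x j i

end Power

/-- A minion: non-empty sets `M^(ℓ)`, `ℓ ≥ 1`, with functorial minor operations. -/
structure Minion where
  obj : ℕ+ → Type*
  nonempty : ∀ ℓ, Nonempty (obj ℓ)
  minor : ∀ {ℓ ℓ' : ℕ+}, (Fin ℓ → Fin ℓ') → obj ℓ → obj ℓ'
  minor_id : ∀ {ℓ : ℕ+} (m : obj ℓ), minor id m = m
  minor_minor : ∀ {ℓ ℓ' ℓ'' : ℕ+} (π : Fin ℓ → Fin ℓ') (ρ : Fin ℓ' → Fin ℓ'') (m : obj ℓ),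
    minor ρ (minor π m) = minor (ρ ∘ π) m

/-- A minion homomorphism: an arity-preserving and minor-preserving map. -/
structure MinionHom (M N : Minion) where
  toFun : ∀ {ℓ : ℕ+}, M.obj ℓ → N.obj ℓ
  map_minor : ∀ {ℓ ℓ' : ℕ+} (π : Fin ℓ → Fin ℓ') (m : M.obj ℓ),
    toFun (M.minor π m) = N.minor π (toFun m)

/-- The minor operation of linear minions: the `i`-th row of the minor is the sum of the rows
with index in `π ⁻¹ {i}`. Rows are elements of `A` (for matrices, `A` is a space of row vectors). -/
def rowMinor {A : Type*} [AddCommMonoid A] {k l : ℕ} (π : Fin k → Fin l) (v : Fin k → A) :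
    Fin l → A :=
  fun i => ∑ j with π j = i, v j

theorem rowMinor_id {A : Type*} [AddCommMonoid A] {k : ℕ} (v : Fin k → A) :
    rowMinor id v = v := by
  funext i
  simp [rowMinor, Finset.filter_eq']

theorem rowMinor_rowMinor {A : Type*} [AddCommMonoid A] {k l m : ℕ} (π : Fin k → Fin l)
    (ρ : Fin l → Fin m) (v : Fin k → A) :
    rowMinor ρ (rowMinor π v) = rowMinor (ρ ∘ π) v := by
  funext i
  simp only [rowMinor, Finset.sum_filter, Function.comp]
  calc _ = ∑ a, ∑ j, (if π j = a then (if ρ a = i then v j else 0) else 0) := by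
        refine Finset.sum_congr rfl fun a _ => ?_
        split_ifs <;> simp
    _ = _ := by
        rw [Finset.sum_comm]
        simp

theorem rowMinor_single {k l : ℕ} (π : Fin k → Fin l) (i : Fin k) :
    rowMinor π (Pi.single i (1 : ℝ)) = Pi.single (π i) 1 := by
  funext a
  simp [rowMinor, Pi.single_apply, eq_comm]

/-- The dictator minion: its elements of arity `ℓ` are the standard unit vectors of length `ℓ`. -/
def dictatorMinion : Minion where
  obj ℓ := {v : Fin ℓ → ℝ // ∃ i, v = Pi.single i 1}
  nonempty ℓ := ⟨⟨Pi.single ⟨0, ℓ.pos⟩ 1, _, rfl⟩⟩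
  minor π v := ⟨rowMinor π v.1, by
    obtain ⟨_, i, rfl⟩ := v
    exact ⟨π i, rowMinor_single π i⟩⟩
  minor_id v := Subtype.ext (rowMinor_id v.1)
  minor_minor π ρ v := Subtype.ext (rowMinor_rowMinor π ρ v.1)

/-- The matrices `M` such that `M Mᵀ` is diagonal of trace one. -/
def IsSDPMatrix {k d : ℕ} (M : Matrix (Fin k) (Fin d) ℝ) : Prop :=
  (M * M.transpose).IsDiag ∧ (M * M.transpose).trace = 1

/-- The minor of a matrix, with rows summed along the fibres of `π`. -/
def matrixMinor {k l d : ℕ} (π : Fin k → Fin l) (M : Matrix (Fin k) (Fin d) ℝ) :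
    Matrix (Fin l) (Fin d) ℝ :=
  Matrix.of (rowMinor (A := Fin d → ℝ) π M)

theorem matrixMinor_apply {k l d : ℕ} (π : Fin k → Fin l) (M : Matrix (Fin k) (Fin d) ℝ)
    (a : Fin l) (c : Fin d) : matrixMinor π M a c = ∑ j with π j = a, M j c :=
  Finset.sum_apply (M := fun _ : Fin d => ℝ) c (Finset.univ.filter fun j => π j = a) fun j => M j

theorem matrixMinor_mul_transpose {k l d : ℕ} (π : Fin k → Fin l) (M : Matrix (Fin k) (Fin d) ℝ)
    (hM : (M * M.transpose).IsDiag) (a b : Fin l) :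
    (matrixMinor π M * (matrixMinor π M).transpose) a b =
      if a = b then ∑ i with π i = a, (M * M.transpose) i i else 0 := by
  have h : (matrixMinor π M * (matrixMinor π M).transpose) a b =
      ∑ i with π i = a, ∑ j with π j = b, (M * M.transpose) i j := by
    simp only [Matrix.mul_apply, Matrix.transpose_apply, matrixMinor_apply, Finset.sum_mul_sum]
    rw [Finset.sum_comm]
    refine Finset.sum_congr rfl fun i _ => ?_
    rw [Finset.sum_comm]
  have h' : ∀ i, ∑ j with π j = b, (M * M.transpose) i j =
      if π i = b then (M * M.transpose) i i else 0 := by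
    intro i
    rw [Finset.sum_filter, Finset.sum_eq_single i]
    · intro j _ hj
      split_ifs
      · exact hM hj.symm
      · rfl
    · simp
  rw [h, Finset.sum_congr rfl fun i _ => h' i]
  split_ifs with hab
  · subst hab
    refine Finset.sum_congr rfl fun i hi => ?_
    simp [(Finset.mem_filter.1 hi).2]
  · refine Finset.sum_eq_zero fun i hi => ?_
    rw [(Finset.mem_filter.1 hi).2]
    simp [hab]

theorem IsSDPMatrix.matrixMinor {k l d : ℕ} (π : Fin k → Fin l) {M : Matrix (Fin k) (Fin d) ℝ}
    (hM : IsSDPMatrix M) : IsSDPMatrix (QuantumPCSP.matrixMinor π M) := by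
  refine ⟨fun a b hab => ?_, ?_⟩
  · exact (matrixMinor_mul_transpose π M hM.1 a b).trans (if_neg hab)
  · rw [← hM.2, Matrix.trace, Matrix.trace]
    calc _ = ∑ a, ∑ i with π i = a, (M * M.transpose) i i :=
          Finset.sum_congr rfl fun a _ =>
            (matrixMinor_mul_transpose π M hM.1 a a).trans (if_pos rfl)
      _ = _ := Finset.sum_fiberwise _ _ _

/-- The minion of semidefinite programming: real matrices `M` of arbitrary finite size such that
`M Mᵀ` is diagonal of trace one; the arity is the number of rows. -/
def sdpMinion : Minion where
  obj ℓ := Σ d : ℕ, {M : Matrix (Fin ℓ) (Fin d) ℝ // IsSDPMatrix M}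
  nonempty ℓ := ⟨⟨1, Matrix.of fun i _ => if i = ⟨0, ℓ.pos⟩ then 1 else 0, by
    refine ⟨fun a b hab => ?_, ?_⟩
    · simp only [Matrix.mul_apply, Matrix.transpose_apply, Matrix.of_apply]
      refine Finset.sum_eq_zero fun _ _ => ?_
      split_ifs with h1 h2
      · exact absurd (h1.trans h2.symm) hab
      all_goals simp
    · simp only [Matrix.trace, Matrix.diag_apply, Matrix.mul_apply, Matrix.transpose_apply,
        Matrix.of_apply, Finset.univ_unique, Finset.sum_singleton, mul_ite, mul_one, mul_zero]
      rw [Finset.sum_eq_single ⟨0, ℓ.pos⟩] <;> simp +contextual⟩⟩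
  minor π M := ⟨M.1, matrixMinor π M.2.1, M.2.2.matrixMinor π⟩
  minor_id M := congrArg (Sigma.mk M.1) (Subtype.ext (rowMinor_id (A := Fin M.1 → ℝ) M.2.1))
  minor_minor π ρ M := congrArg (Sigma.mk M.1)
    (Subtype.ext (rowMinor_rowMinor (A := Fin M.1 → ℝ) π ρ M.2.1))

section Structures

variable {L : Language}

/-- The minor of a polymorphism: `f_{/π}(s_1, …, s_ℓ') = f(s_{π(1)}, …, s_{π(ℓ)})`. -/
def polMinor {Y Y' : Type*} [L.Structure Y] [L.Structure Y'] [L.IsRelational] {k l : ℕ}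
    (π : Fin k → Fin l) (f : DirectPower Y k →[L] Y') : DirectPower Y l →[L] Y' where
  toFun s := f fun i => s (π i)
  map_fun' g := isEmptyElim g
  map_rel' R x hx := f.map_rel R (fun j i => x j (π i)) fun i => hx (π i)

/-- The polymorphism minion `Pol(Y, Y')` of a pair `Y → Y'`: its elements of arity `ℓ` are the
homomorphisms from `Y ^ ℓ` to `Y'`. -/
def polMinion (L : Language) [L.IsRelational] (Y Y' : Type*) [L.Structure Y] [L.Structure Y']
    (h : Nonempty (Y →[L] Y')) : Minion where
  obj ℓ := DirectPower Y ℓ →[L] Y'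
  nonempty ℓ := h.map fun f =>
    { toFun := fun s => f (s ⟨0, ℓ.pos⟩)
      map_fun' := fun g => isEmptyElim g
      map_rel' := fun R x hx => f.map_rel R (fun j => x j ⟨0, ℓ.pos⟩) (hx ⟨0, ℓ.pos⟩) }
  minor π f := polMinor π f
  minor_id _ := rfl
  minor_minor _ _ _ := rfl

/-- A family `p x y` of orthogonal projectors of `H` that witnesses that `X` and `Y` are quantum
homomorphic over `H`. -/
structure IsQuantumHom (L : Language) {X Y 𝕜 H : Type*} [L.Structure X] [L.Structure Y]
    [Fintype Y] [RCLike 𝕜] [NormedAddCommGroup H] [InnerProductSpace 𝕜 H]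
    (p : X → Y → Module.End 𝕜 H) : Prop where
  isProj : ∀ x y, (p x y).IsSymmetricProjection
  sum_eq_one : ∀ x, ∑ y, p x y = 1
  commute : ∀ {n : ℕ} (R : L.Relations n) (x : Fin n → X), Structure.RelMap R x →
    ∀ (i j : Fin n) (y y' : Y), p (x i) y * p (x j) y' = p (x j) y' * p (x i) y
  prod_eq_zero : ∀ {n : ℕ} (R : L.Relations n) (x : Fin n → X) (y : Fin n → Y),
    Structure.RelMap R x → ¬ Structure.RelMap R y →
      (List.ofFn fun i => p (x i) (y i)).prod = 0

/-- `X` and `Y` are quantum homomorphic over `H`. -/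
def QuantumHomomorphic (L : Language) (X Y 𝕜 H : Type*) [L.Structure X] [L.Structure Y]
    [Fintype Y] [RCLike 𝕜] [NormedAddCommGroup H] [InnerProductSpace 𝕜 H] : Prop :=
  ∃ p : X → Y → Module.End 𝕜 H, IsQuantumHom L p

/-- The pair `(Y, Y')` has quantum advantage over `H`: some finite structure `X` is quantum
homomorphic to `Y` over `H` but not homomorphic to `Y'`. (Up to isomorphism, the finite structures
are those with domain in `Type`.) -/
def HasQuantumAdvantage (L : Language) (Y Y' 𝕜 H : Type*) [L.Structure Y] [L.Structure Y']
    [Fintype Y] [RCLike 𝕜] [NormedAddCommGroup H] [InnerProductSpace 𝕜 H] : Prop :=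
  ∃ (X : Type) (_ : Finite X) (_ : L.Structure X),
    QuantumHomomorphic L X Y 𝕜 H ∧ IsEmpty (X →[L] Y')

end Structures

end QuantumPCSP

/-! In dimension at most two, a projector other than 0 and 1 has kernel and range of dimension at
most one. Any idempotent commuting with it is therefore diagonal on these lines. Call `x` trivial if
all its projectors are 0 or 1. Commuting nontrivial elements have the same common eigenvectors.
Choosing one eigenvector per eigenvector set and reading off which projector fixes it gives a
homomorphism to `Y` (`IsQuantumHom.nonempty_hom`), and hence one to `Y'`.

In dimension at least three, take a finite Kochen–Specker family of orthogonal bases. Let `X`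
consist of all `Y`-valued coarse-grainings of the associated measurements; it is quantum homomorphic
to `Y` by construction. A homomorphism `X → Y'` restricts to one polymorphism per basis, and bases
sharing a line give polymorphisms with a common binary minor. Mapped to dictators, these become a
choice of one line per basis, consistent across bases, which Kochen–Specker forbids
(`hasQuantumAdvantage_of_contexts`, `not_exists_choice_triadBasis`).

For the semidefinite minion, fix a unit vector `v`. The orthogonal vectors `p x y v` sum to `v`, so
their real coordinates form a matrix of the minion for each `x`. For a related tuple, the products
of projectors applied to `v`, indexed by the tuples of `R` in `Y`, form a matrix having those of the
entries as minors. A minion homomorphism turns this into preservation of `R`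
(`IsQuantumHom.nonempty_hom_of_sdp`). -/

namespace QuantumPCSP

open FirstOrder FirstOrder.Language

/-! ### Kochen–Specker for integer vectors in dimension three. -/

section KochenSpecker

/-- Three pairwise orthogonal nonzero integer vectors with entries of absolute value at most `8`. -/
def IsTriad (T : Fin 3 → Fin 3 → ℤ) : Prop :=
  (∀ a, T a ≠ 0) ∧ (∀ a b, a ≠ b → T a ⬝ᵥ T b = 0) ∧ ∀ a i, -8 ≤ T a i ∧ T a i ≤ 8

instance : DecidablePred IsTriad := fun T => by unfold IsTriad; infer_instance

/-- A Kochen–Specker colouring: every triad has exactly one coloured vector. -/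
structure IsColoring (col : (Fin 3 → ℤ) → Prop) : Prop where
  exists_mem : ∀ T, IsTriad T → ∃ a, col (T a)
  unique : ∀ T, IsTriad T → ∀ a b, col (T a) → col (T b) → a = b

namespace IsColoring

variable {col : (Fin 3 → ℤ) → Prop}

theorem comp (h : IsColoring col) {f : (Fin 3 → ℤ) → Fin 3 → ℤ}
    (hf : ∀ T, IsTriad T → IsTriad fun a => f (T a)) : IsColoring fun v => col (f v) where
  exists_mem T hT := h.exists_mem _ (hf T hT)
  unique T hT := h.unique _ (hf T hT)

theorem not_right (h : IsColoring col) {u v : Fin 3 → ℤ} (w : Fin 3 → ℤ)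
    (hT : IsTriad ![u, v, w]) (hu : col u) : ¬ col v := fun hv =>
  absurd (h.unique _ hT 0 1 hu hv) (by decide)

theorem of_not_of_not (h : IsColoring col) {u v w : Fin 3 → ℤ} (hu : ¬ col u) (hv : ¬ col v)
    (hT : IsTriad ![u, v, w]) : col w := by
  obtain ⟨a, ha⟩ := h.exists_mem _ hT
  fin_cases a
  exacts [absurd ha hu, absurd ha hv, ha]

/-- Orthogonality forces colours along two chains, ending with the orthogonal vectors `(1,0,-1)`,
`(1,0,1)` and `(0,1,0)` all uncoloured. -/
theorem false_of_diagonal (h : IsColoring col) (h1 : col ![0, 0, 1]) (h2 : col ![0, 1, -1]) :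
    False := by
  have n010 : ¬ col ![0, 1, 0] := h.not_right ![1, 0, 0] (by decide) h1
  have n011 : ¬ col ![0, 1, 1] := h.not_right ![1, 0, 0] (by decide) h2
  have a1 : ¬ col ![1, -1, -1] := h.not_right ![2, 1, 1] (by decide) h2
  have a2 : ¬ col ![1, 1, 0] := h.not_right ![1, -1, 0] (by decide) h1
  have a3 : col ![1, -1, 2] := h.of_not_of_not a1 a2 (by decide)
  have a4 : ¬ col ![2, 0, -1] := h.not_right ![1, 5, 2] (by decide) a3
  have a5 : col ![1, 0, 2] := h.of_not_of_not a4 n010 (by decide)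
  have a6 : ¬ col ![2, 1, -1] := h.not_right ![-2, 5, 1] (by decide) a5
  have a7 : col ![1, -1, 1] := h.of_not_of_not a6 n011 (by decide)
  have a8 : ¬ col ![1, 0, -1] := h.not_right ![1, 2, 1] (by decide) a7
  -- The second chain mirrors the first in the first coordinate, up to sign.
  have b1 : ¬ col ![1, 1, 1] := h.not_right ![-2, 1, 1] (by decide) h2
  have b2 : ¬ col ![1, -1, 0] := h.not_right ![1, 1, 0] (by decide) h1
  have b3 : col ![1, 1, -2] := h.of_not_of_not b1 b2 (by decide)
  have b4 : ¬ col ![2, 0, 1] := h.not_right ![1, -5, -2] (by decide) b3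
  have b5 : col ![1, 0, -2] := h.of_not_of_not b4 n010 (by decide)
  have b6 : ¬ col ![2, -1, 1] := h.not_right ![2, 5, 1] (by decide) b5
  have b7 : col ![1, 1, -1] := h.of_not_of_not b6 n011 (by decide)
  have b8 : ¬ col ![1, 0, 1] := h.not_right ![1, -2, -1] (by decide) b7
  exact b8 (h.of_not_of_not a8 n010 (by decide))

theorem isTriad_reflect {T : Fin 3 → Fin 3 → ℤ} (hT : IsTriad T) :
    IsTriad fun a => ![T a 0, -T a 1, T a 2] := by
  obtain ⟨h0, h1, h2⟩ := hT
  refine ⟨fun a ha => h0 a ?_, fun a b hab => ?_, fun a i => ?_⟩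
  · have e0 := congrFun ha 0
    have e1 := congrFun ha 1
    have e2 := congrFun ha 2
    simp only [Matrix.cons_val, Pi.zero_apply, neg_eq_zero] at e0 e1 e2
    funext i
    fin_cases i <;> assumption
  · have := h1 a b hab
    simp only [dotProduct, Fin.sum_univ_three, Matrix.cons_val] at this ⊢
    linarith
  · have := h2 a i
    fin_cases i <;> simp at this ⊢ <;> omega

theorem isTriad_permute (σ : Equiv.Perm (Fin 3)) {T : Fin 3 → Fin 3 → ℤ} (hT : IsTriad T) :
    IsTriad fun a i => T a (σ i) := by
  obtain ⟨h0, h1, h2⟩ := hT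
  refine ⟨fun a ha => h0 a ?_, fun a b hab => ?_, fun a i => h2 a (σ i)⟩
  · funext i
    simpa using congrFun ha (σ.symm i)
  · rw [← h1 a b hab]
    exact Equiv.sum_comp σ fun i => T a i * T b i

theorem false_of_axis (h : IsColoring col) (h1 : col ![0, 0, 1]) : False := by
  by_cases h2 : col ![0, 1, -1]
  · exact h.false_of_diagonal h1 h2
  -- In the triad of `(0,1,-1)`, `(1,0,0)` and `(0,-1,-1)` only the last can be coloured; a
  -- reflection returns to the diagonal case.
  · have h3 : col ![0, -1, -1] := by
      refine h.of_not_of_not h2 (h.not_right ![0, 1, 0] ?_ h1 : ¬ col ![1, 0, 0]) ?_ <;> decide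
    exact (h.comp (f := fun v => ![v 0, -v 1, v 2]) fun T => isTriad_reflect).false_of_diagonal
      (by simpa using h1) (by simpa using h3)

/-- The Kochen–Specker theorem, for integer vectors in dimension three. -/
theorem false (h : IsColoring col) : False := by
  obtain ⟨a, ha⟩ := h.exists_mem (fun a => Pi.single a 1) (by decide)
  refine (h.comp (f := fun v i => v (Equiv.swap a 2 i))
    fun T => isTriad_permute (Equiv.swap a 2)).false_of_axis ?_
  convert ha using 1
  clear ha
  revert a
  decide

end IsColoring

end KochenSpecker

/-! ### From projective measurements to quantum advantage. -/

section Contexts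

variable {𝕜 H : Type*} [RCLike 𝕜] [NormedAddCommGroup H] [InnerProductSpace 𝕜 H]

/-- A projective measurement: orthogonal projectors, pairwise orthogonal, with sum the identity. -/
structure IsContext {n : ℕ} (c : Fin n → Module.End 𝕜 H) : Prop where
  isProj : ∀ k, (c k).IsSymmetricProjection
  mul_eq_zero : ∀ k l, k ≠ l → c k * c l = 0
  sum_eq_one : ∑ k, c k = 1

/-- The coarse-graining of a family of operators along a map of the index set. -/
noncomputable def coarse {Y : Type*} {n : ℕ} (c : Fin n → Module.End 𝕜 H) (g : Fin n → Y) (y : Y) :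
    Module.End 𝕜 H :=
  open scoped Classical in ∑ k with g k = y, c k

namespace IsContext

variable {n : ℕ} {c : Fin n → Module.End 𝕜 H} {Y : Type*}

theorem mul_self (hc : IsContext c) (k : Fin n) : c k * c k = c k := (hc.isProj k).1

open scoped Classical in
theorem coarse_mul (hc : IsContext c) (g : Fin n → Y) (y : Y) (k : Fin n) :
    coarse c g y * c k = if g k = y then c k else 0 := by
  rw [coarse, Finset.sum_mul, Finset.sum_filter, Finset.sum_eq_single k]
  · rw [hc.mul_self]
  · intro l _ hl
    rw [hc.mul_eq_zero l k hl, ite_self]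
  · simp

theorem ext_mul (hc : IsContext c) {S T : Module.End 𝕜 H} (h : ∀ k, S * c k = T * c k) :
    S = T := by
  rw [← mul_one S, ← mul_one T, ← hc.sum_eq_one, Finset.mul_sum, Finset.mul_sum]
  exact Finset.sum_congr rfl fun k _ => h k

theorem isProj_coarse (hc : IsContext c) (g : Fin n → Y) (y : Y) :
    (coarse c g y).IsSymmetricProjection where
  isIdempotentElem := hc.ext_mul fun k => by
    rw [mul_assoc, hc.coarse_mul]
    split_ifs with h
    · rw [hc.coarse_mul, if_pos h]
    · rw [mul_zero]
  isSymmetric := by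
    intro u v
    simp only [coarse, LinearMap.sum_apply, sum_inner, inner_sum]
    exact Finset.sum_congr rfl fun k _ => (hc.isProj k).2 u v

theorem sum_coarse [Fintype Y] (hc : IsContext c) (g : Fin n → Y) : ∑ y, coarse c g y = 1 := by
  classical
  rw [← hc.sum_eq_one, ← Finset.sum_fiberwise Finset.univ g c]
  refine Finset.sum_congr rfl fun y _ => ?_
  unfold coarse
  congr!

theorem coarse_comm (hc : IsContext c) (g g' : Fin n → Y) (y y' : Y) :
    coarse c g y * coarse c g' y' = coarse c g' y' * coarse c g y :=
  hc.ext_mul fun k => by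
    simp only [mul_assoc, hc.coarse_mul, mul_ite, mul_zero]
    split_ifs <;> rfl

/-- Each factor acts on the range of `c k` as 0 or 1, and for every `k` some factor acts as 0. -/
theorem prod_coarse_eq_zero (hc : IsContext c) {r : ℕ} (g : Fin r → Fin n → Y) (y : Fin r → Y)
    (h : ∀ k, ∃ i, g i k ≠ y i) : (List.ofFn fun i => coarse c (g i) (y i)).prod = 0 := by
  have key : ∀ k, ∀ l : List ((Fin n → Y) × Y), (∃ a ∈ l, a.1 k ≠ a.2) →
      (l.map fun a => coarse c a.1 a.2).prod * c k = 0 := by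
    intro k l
    induction l with
    | nil => simp
    | cons a l ih =>
      intro hl
      rw [List.map_cons, List.prod_cons, mul_assoc]
      by_cases hl' : ∃ a ∈ l, a.1 k ≠ a.2
      · rw [ih hl', mul_zero]
      · have hmul : (l.map fun a => coarse c a.1 a.2).prod * c k = c k := by
          clear ih hl
          induction l with
          | nil => simp
          | cons b l ih =>
            simp only [List.mem_cons, not_exists, not_and, not_not] at hl' ih
            rw [List.map_cons, List.prod_cons, mul_assoc, ih fun a ha => hl' a (Or.inr ha),
              hc.coarse_mul, if_pos (hl' b (Or.inl rfl))]
        obtain ⟨b, hb, hbk⟩ := hl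
        rcases List.mem_cons.1 hb with rfl | hb
        · rw [hmul, hc.coarse_mul, if_neg hbk]
        · exact absurd ⟨b, hb, hbk⟩ hl'
  refine hc.ext_mul fun k => ?_
  have := key k (List.ofFn fun i => (g i, y i)) ?_
  · rw [zero_mul, ← this, List.map_ofFn]
    rfl
  · obtain ⟨i, hi⟩ := h k
    exact ⟨(g i, y i), (List.mem_ofFn' _ _).2 ⟨i, rfl⟩, hi⟩

end IsContext

/-- The map to two values that singles out the index `i`. -/
def separate {n : ℕ} (i : Fin n) (k : Fin n) : Fin (2 : ℕ+) := if k = i then 0 else 1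

-- The right-hand side involves only the projector `c i`, not the rest of the context; this is what
-- links contexts sharing a projector.
open scoped Classical in
theorem IsContext.coarse_separate {n : ℕ} {c : Fin n → Module.End 𝕜 H} (hc : IsContext c)
    {Y : Type*} (i : Fin n) (s : Fin (2 : ℕ+) → Y) (y : Y) :
    coarse c (fun k => s (separate i k)) y =
      (if s 0 = y then c i else 0) + if s 1 = y then 1 - c i else 0 := by
  refine hc.ext_mul fun k => ?_
  rw [hc.coarse_mul, add_mul]
  by_cases hk : k = i
  · subst hk
    simp only [separate, if_true, ite_mul, zero_mul, sub_mul, one_mul, hc.mul_self, sub_self,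
      ite_self, add_zero]
  · simp only [separate, hk, if_false, ite_mul, zero_mul, sub_mul, one_mul,
      hc.mul_eq_zero i k (Ne.symm hk), sub_zero, ite_self, zero_add]

variable {ι Y : Type*} {n : ℕ}

/-- The coarse-grainings of a family of contexts. -/
def Coarsening (Y : Type*) (c : ι → Fin n → Module.End 𝕜 H) : Type _ :=
  Set.range fun a : ι × (Fin n → Y) => coarse (c a.1) a.2

/-- A coarse-graining of a context of the family. -/
noncomputable def Coarsening.mk (c : ι → Fin n → Module.End 𝕜 H) (i : ι) (g : Fin n → Y) :
    Coarsening Y c :=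
  ⟨_, (i, g), rfl⟩

instance [Finite ι] [Finite Y] (c : ι → Fin n → Module.End 𝕜 H) : Finite (Coarsening Y c) :=
  Set.finite_range _

/-- A tuple of coarse-grainings of one context is related iff each of its fibres is. -/
noncomputable instance {L : Language} [L.IsRelational] [L.Structure Y]
    (c : ι → Fin n → Module.End 𝕜 H) :
    L.Structure (Coarsening Y c) where
  funMap f := isEmptyElim f
  RelMap R x := ∃ (i : ι) (g : Fin _ → Fin n → Y), (∀ j, x j = Coarsening.mk c i (g j)) ∧
    ∀ k, Structure.RelMap R fun j => g j k

theorem isQuantumHom_coarsening {L : Language} [L.IsRelational] [L.Structure Y] [Fintype Y]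
    {c : ι → Fin n → Module.End 𝕜 H} (hc : ∀ i, IsContext (c i)) :
    IsQuantumHom L fun (x : Coarsening Y c) y => x.1 y where
  isProj x y := by
    obtain ⟨_, ⟨i, g⟩, rfl⟩ := x
    exact (hc i).isProj_coarse g y
  sum_eq_one x := by
    obtain ⟨_, ⟨i, g⟩, rfl⟩ := x
    exact (hc i).sum_coarse g
  commute R x hx j j' y y' := by
    obtain ⟨i, g, hg, -⟩ := hx
    rw [hg, hg]
    exact (hc i).coarse_comm _ _ _ _
  prod_eq_zero R x y hx hy := by
    obtain ⟨i, g, hg, hR⟩ := hx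
    simp only [hg]
    refine (hc i).prod_coarse_eq_zero g y fun k => ?_
    by_contra! hk
    exact hy (by simpa only [hk] using hR k)

/-- A homomorphism from the coarse-grainings restricts to polymorphisms on the contexts. -/
noncomputable def coarseningPol {L : Language} [L.IsRelational] [L.Structure Y] {Y' : Type*}
    [L.Structure Y']
    {c : ι → Fin n → Module.End 𝕜 H} (F : Coarsening Y c →[L] Y') (i : ι) :
    DirectPower Y n →[L] Y' where
  toFun g := F (Coarsening.mk c i g)
  map_fun' f := isEmptyElim f
  map_rel' R g hg := F.map_rel R _ ⟨i, g, fun _ => rfl, hg⟩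

/-- Elements of `Coarsening` are operator families, not pairs of a context and a map, so both minors
evaluate `F` at the same point. -/
theorem polMinor_coarseningPol {L : Language} [L.IsRelational] [L.Structure Y] {Y' : Type*}
    [L.Structure Y'] {c : ι → Fin n → Module.End 𝕜 H} (hc : ∀ i, IsContext (c i))
    (F : Coarsening Y c →[L] Y') {i i' : ι} {k k' : Fin n} (h : c i k = c i' k') :
    polMinor (separate k) (coarseningPol F i) = polMinor (separate k') (coarseningPol F i') := by
  ext s
  refine congrArg F (Subtype.ext (funext fun y => ?_))
  exact ((hc i).coarse_separate k s y).trans (h ▸ ((hc i').coarse_separate k' s y).symm)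

theorem QuantumHomomorphic.hasQuantumAdvantage {L : Language} {X Y' : Type*} [Finite X]
    [Fintype Y] [L.Structure X] [L.Structure Y] [L.Structure Y']
    (hX : QuantumHomomorphic L X Y 𝕜 H) (hX' : IsEmpty (X →[L] Y')) :
    HasQuantumAdvantage L Y Y' 𝕜 H := by
  obtain ⟨m, ⟨e⟩⟩ := Finite.exists_equiv_fin X
  let _ : L.Structure (Fin m) := e.inducedStructure
  refine ⟨Fin m, inferInstance, inferInstance, ?_, ⟨fun f => hX'.false
    (f.comp (e.inducedStructureEquiv (L := L)).toHom)⟩⟩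
  obtain ⟨p, hp⟩ := hX
  exact ⟨fun a => p (e.symm a),
    { isProj := fun _ => hp.isProj _
      sum_eq_one := fun _ => hp.sum_eq_one _
      commute := fun R x hx => hp.commute R (e.symm ∘ x) hx
      prod_eq_zero := fun R x y hx => hp.prod_eq_zero R (e.symm ∘ x) y hx }⟩

/-- If the polymorphism minion maps to dictators, then finitely many contexts without consistent
choice of one outcome each give rise to quantum advantage. -/
theorem hasQuantumAdvantage_of_contexts {L : Language} [L.IsRelational] [L.Structure Y]
    {Y' : Type*} [L.Structure Y'] [Fintype Y] [Finite ι] (h : Nonempty (Y →[L] Y'))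
    (ξ : MinionHom (polMinion L Y Y' h) dictatorMinion)
    {n : ℕ+} {c : ι → Fin n → Module.End 𝕜 H} (hc : ∀ i, IsContext (c i))
    (hcol : ∀ t : ι → Fin n, ¬ ∀ i i' k k', c i k = c i' k' → t i = k → t i' = k') :
    HasQuantumAdvantage L Y Y' 𝕜 H := by
  refine QuantumHomomorphic.hasQuantumAdvantage (X := Coarsening Y c)
    ⟨_, isQuantumHom_coarsening hc⟩ ⟨fun F => ?_⟩
  let f : ι → (polMinion L Y Y' h).obj n := fun i => coarseningPol F i
  choose t ht using fun i => (ξ.toFun (f i)).2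
  refine hcol t fun i i' k k' hk hik => ?_
  have hsep : ∀ i k, (ξ.toFun ((polMinion L Y Y' h).minor (ℓ' := 2) (separate k)
      (f i))).1 = Pi.single (separate k (t i)) 1 := by
    intro i k
    rw [ξ.map_minor]
    exact (congrArg _ (ht i)).trans (rowMinor_single _ _)
  have hpol : (polMinion L Y Y' h).minor (ℓ' := 2) (separate k) (f i) =
      (polMinion L Y Y' h).minor (ℓ' := 2) (separate k') (f i') :=
    polMinor_coarseningPol hc F hk
  have heq := (hsep i k).symm.trans ((congrArg (fun m => (ξ.toFun m).1) hpol).trans (hsep i' k'))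
  -- Entry 0 of the binary minor records whether the dictator coordinate is the separated index.
  have h0 := congrFun heq 0
  by_contra hne
  rw [show separate k (t i) = 0 from if_pos hik, show separate k' (t i') = 1 from if_neg hne,
    Pi.single_eq_same, Pi.single_eq_of_ne (by decide)] at h0
  exact one_ne_zero h0

end Contexts

/-! ### Kochen–Specker bases in every dimension at least three. -/

section KochenSpeckerContexts

variable {𝕜 H : Type*} [RCLike 𝕜] [NormedAddCommGroup H] [InnerProductSpace 𝕜 H]

/-- The orthogonal projector onto the line spanned by a vector. -/
noncomputable def lineProj (𝕜 : Type*) {H : Type*} [RCLike 𝕜] [NormedAddCommGroup H]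
    [InnerProductSpace 𝕜 H] (v : H) : Module.End 𝕜 H :=
  ((𝕜 ∙ v).starProjection : H →L[𝕜] H)

theorem lineProj_self (v : H) : lineProj 𝕜 v v = v :=
  Submodule.starProjection_eq_self_iff.2 (Submodule.mem_span_singleton_self v)

theorem lineProj_of_inner_eq_zero {v w : H} (h : inner 𝕜 v w = 0) : lineProj 𝕜 v w = 0 :=
  (Submodule.starProjection_apply_eq_zero_iff _).2
    (Submodule.mem_orthogonal_singleton_iff_inner_right.2 h)

theorem isContext_lineProj {n : ℕ} {w : Fin n → H} (hn : Module.finrank 𝕜 H = n)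
    (hpos : 0 < n)
    (h0 : ∀ k, w k ≠ 0) (h : Pairwise fun k l => inner 𝕜 (w k) (w l) = 0) :
    IsContext fun k => lineProj 𝕜 (w k) where
  isProj k := Submodule.isSymmetricProjection_starProjection _
  mul_eq_zero k l hkl := by
    ext x
    obtain ⟨a, ha⟩ := Submodule.mem_span_singleton.1
      (Submodule.starProjection_apply_mem (𝕜 ∙ w l) x)
    change lineProj 𝕜 (w k) (lineProj 𝕜 (w l) x) = 0
    rw [show lineProj 𝕜 (w l) x = a • w l from ha.symm, map_smul,
      lineProj_of_inner_eq_zero (h hkl), smul_zero]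
  sum_eq_one := by
    have : Nonempty (Fin n) := ⟨⟨0, hpos⟩⟩
    have hli : LinearIndependent 𝕜 w := linearIndependent_of_ne_zero_of_inner_eq_zero h0 h
    refine (basisOfLinearIndependentOfCardEqFinrank hli (by simp [hn])).ext fun k => ?_
    rw [coe_basisOfLinearIndependentOfCardEqFinrank, LinearMap.sum_apply, Finset.sum_eq_single k]
    · exact lineProj_self _
    · intro l _ hl
      exact lineProj_of_inner_eq_zero (h hl)
    · simp

/-- The vector with the given integer coordinates in an orthonormal family. -/
noncomputable def intVec {m : ℕ} (b : Fin m → H) (v : Fin m → ℤ) : H := ∑ i, (v i : 𝕜) • b i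

theorem inner_intVec {m : ℕ} {b : Fin m → H} (hb : Orthonormal 𝕜 b) (u v : Fin m → ℤ) :
    inner 𝕜 (intVec (𝕜 := 𝕜) b u) (intVec (𝕜 := 𝕜) b v) = ((u ⬝ᵥ v : ℤ) : 𝕜) := by
  rw [intVec, intVec, hb.inner_sum]
  simp [dotProduct]

theorem intVec_ne_zero {m : ℕ} {b : Fin m → H} (hb : Orthonormal 𝕜 b) {v : Fin m → ℤ}
    (hv : v ≠ 0) : intVec (𝕜 := 𝕜) b v ≠ 0 := by
  intro h
  have := inner_intVec hb v v
  rw [h, inner_zero_left, eq_comm, Int.cast_eq_zero] at this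
  exact hv (dotProduct_self_eq_zero.1 this)

theorem intVec_single {m : ℕ} (b : Fin m → H) (a : Fin m) :
    intVec (𝕜 := 𝕜) b (Pi.single a 1) = b a := by
  rw [intVec, Finset.sum_eq_single a]
  · simp
  · intro i _ hi
    simp [Pi.single_eq_of_ne hi]
  · simp

theorem inner_intVec_right {m n : ℕ} {b : Fin n → H} (hb : Orthonormal 𝕜 b) (s : Fin m ↪ Fin n)
    (v : Fin m → ℤ) {k : Fin n} (hk : ¬ ∃ a, s a = k) :
    inner 𝕜 (b k) (intVec (𝕜 := 𝕜) (b ∘ s) v) = 0 := by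
  rw [intVec, inner_sum]
  refine Finset.sum_eq_zero fun i _ => ?_
  rw [inner_smul_right, Function.comp, hb.2 fun h => hk ⟨i, h.symm⟩, mul_zero]

/-- The triads of integer vectors. -/
abbrev Triad : Type := {T : Fin 3 → Fin 3 → ℤ // IsTriad T}

/-- The entry bound in `IsTriad` serves to keep the family of contexts finite; the explicit triads
of the colouring argument have entries at most 5 in absolute value. -/
instance : Finite Triad := by
  refine ((Set.finite_Icc (fun _ _ => -8 : Fin 3 → Fin 3 → ℤ) fun _ _ => 8).subset ?_).to_subtype
  exact fun T hT => ⟨fun a i => (hT.2.2 a i).1, fun a i => (hT.2.2 a i).2⟩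

/-- The standard basis as a triad. -/
def standardTriad : Triad := ⟨fun a => Pi.single a 1, by decide⟩

/-- The orthogonal basis in which a triad replaces three vectors of an orthonormal basis. -/
noncomputable def triadBasis {n : ℕ} (𝕜 : Type*) [RCLike 𝕜] [InnerProductSpace 𝕜 H]
    (b : Fin n → H) (i : (Fin 3 ↪ Fin n) × Triad) : Fin n → H :=
  Function.extend i.1 (fun a => intVec (𝕜 := 𝕜) (b ∘ i.1) (i.2.1 a)) b

variable {n : ℕ} {b : Fin n → H}

theorem triadBasis_apply (s : Fin 3 ↪ Fin n) (T : Triad) (a : Fin 3) :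
    triadBasis 𝕜 b (s, T) (s a) = intVec (𝕜 := 𝕜) (b ∘ s) (T.1 a) :=
  s.injective.extend_apply _ _ _

theorem triadBasis_of_notMem (s : Fin 3 ↪ Fin n) (T : Triad) {k : Fin n} (hk : ¬ ∃ a, s a = k) :
    triadBasis 𝕜 b (s, T) k = b k :=
  Function.extend_apply' _ _ _ hk

theorem triadBasis_standard (s : Fin 3 ↪ Fin n) : triadBasis 𝕜 b (s, standardTriad) = b := by
  funext k
  by_cases hk : ∃ a, s a = k
  · obtain ⟨a, rfl⟩ := hk
    rw [triadBasis_apply]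
    exact intVec_single _ a
  · exact triadBasis_of_notMem s _ hk

theorem triadBasis_ne_zero (hb : Orthonormal 𝕜 b) (i : (Fin 3 ↪ Fin n) × Triad) (k : Fin n) :
    triadBasis 𝕜 b i k ≠ 0 := by
  obtain ⟨s, T⟩ := i
  by_cases hk : ∃ a, s a = k
  · obtain ⟨a, rfl⟩ := hk
    rw [triadBasis_apply]
    exact intVec_ne_zero (hb.comp s s.injective) (T.2.1 a)
  · rw [triadBasis_of_notMem s T hk]
    exact hb.ne_zero k

theorem inner_triadBasis (hb : Orthonormal 𝕜 b) (i : (Fin 3 ↪ Fin n) × Triad) :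
    Pairwise fun k l => inner 𝕜 (triadBasis 𝕜 b i k) (triadBasis 𝕜 b i l) = 0 := by
  obtain ⟨s, T⟩ := i
  intro k l hkl
  by_cases hk : ∃ a, s a = k <;> by_cases hl : ∃ a, s a = l
  · obtain ⟨a, rfl⟩ := hk
    obtain ⟨a', rfl⟩ := hl
    simp only [triadBasis_apply]
    rw [inner_intVec (hb.comp s s.injective), T.2.2.1 a a' fun h => hkl (congrArg s h),
      Int.cast_zero]
  · obtain ⟨a, rfl⟩ := hk
    simp only [triadBasis_apply, triadBasis_of_notMem s T hl]
    rw [inner_eq_zero_symm]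
    exact inner_intVec_right hb s _ hl
  · obtain ⟨a, rfl⟩ := hl
    simp only [triadBasis_apply, triadBasis_of_notMem s T hk]
    exact inner_intVec_right hb s _ hk
  · simp only [triadBasis_of_notMem s T hk, triadBasis_of_notMem s T hl]
    exact hb.2 hkl

/-- The Kochen–Specker theorem: in dimension at least three, there is no choice of one line from
each of the orthogonal bases `triadBasis` that is consistent across bases. -/
theorem not_exists_choice_triadBasis (hn : 3 ≤ n) (b : Fin n → H)
    (t : (Fin 3 ↪ Fin n) × Triad → Fin n)
    (ht : ∀ i i' k k', lineProj 𝕜 (triadBasis 𝕜 b i k) = lineProj 𝕜 (triadBasis 𝕜 b i' k') →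
      t i = k → t i' = k') : False := by
  have hcongr : ∀ i i' k k', triadBasis 𝕜 b i k = triadBasis 𝕜 b i' k' → t i = k → t i' = k' :=
    fun i i' k k' h => ht i i' k k' (congrArg _ h)
  have hstd : ∀ s s', t (s, standardTriad) = t (s', standardTriad) := fun s s' =>
    (hcongr (s, _) (s', _) _ _ (by rw [triadBasis_standard, triadBasis_standard]) rfl).symm
  let s₀ : Fin 3 ↪ Fin n := Fin.castLEEmb hn
  -- The swap puts the line chosen from `b` itself among the three that get replaced.
  let s : Fin 3 ↪ Fin n := s₀.trans (Equiv.swap (s₀ 0) (t (s₀, standardTriad))).toEmbedding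
  have hs : t (s, standardTriad) = s 0 := by
    rw [hstd s s₀]
    change _ = Equiv.swap (s₀ 0) (t (s₀, standardTriad)) (s₀ 0)
    rw [Equiv.swap_apply_left]
  -- A line chosen outside the range of `s` also belongs to `b`, so `b` would choose it too,
  -- contradicting `hs`.
  have hmem : ∀ T, ∃ a, s a = t (s, T) := by
    intro T
    by_contra hT
    refine hT ⟨0, ?_⟩
    rw [← hs]
    refine hcongr (s, T) (s, standardTriad) _ _ ?_ rfl
    rw [triadBasis_of_notMem s T hT, triadBasis_standard]
  choose a ha using hmem
  have hmove : ∀ T T' : Triad, ∀ j, T.1 (a T) = T'.1 j → a T' = j := by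
    intro T T' j h
    refine s.injective ?_
    rw [ha]
    refine hcongr (s, T) (s, T') (s (a T)) (s j) ?_ (ha T).symm
    rw [triadBasis_apply, triadBasis_apply, h]
  refine IsColoring.false (col := fun v => ∃ T : Triad, T.1 (a T) = v) ⟨fun T hT => ?_, ?_⟩
  · exact ⟨a ⟨T, hT⟩, ⟨T, hT⟩, rfl⟩
  · rintro T hT j j' ⟨T₁, h₁⟩ ⟨T₂, h₂⟩
    exact (hmove T₁ ⟨T, hT⟩ j h₁).symm.trans (hmove T₂ ⟨T, hT⟩ j' h₂)

theorem hasQuantumAdvantage_of_dictator {L : Language} [L.IsRelational] {Y Y' : Type*}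
    [L.Structure Y] [L.Structure Y'] [Fintype Y] (h : Nonempty (Y →[L] Y'))
    (ξ : MinionHom (polMinion L Y Y' h) dictatorMinion) [FiniteDimensional 𝕜 H]
    (hdim : 3 ≤ Module.finrank 𝕜 H) : HasQuantumAdvantage L Y Y' 𝕜 H := by
  let b := stdOrthonormalBasis 𝕜 H
  exact hasQuantumAdvantage_of_contexts (n := ⟨Module.finrank 𝕜 H, by omega⟩) h ξ
    (fun i => isContext_lineProj rfl (PNat.pos _) (triadBasis_ne_zero b.orthonormal i)
      (inner_triadBasis b.orthonormal i))
    fun t ht => not_exists_choice_triadBasis hdim b t ht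

end KochenSpeckerContexts

/-! ### No advantage in dimension at most two. -/

section LowDimension

variable {𝕜 H : Type*} [RCLike 𝕜] [NormedAddCommGroup H] [InnerProductSpace 𝕜 H]

theorem prod_ofFn_apply_eq_self {r : ℕ} (q : Fin r → Module.End 𝕜 H) {v : H}
    (h : ∀ i, q i v = v) : (List.ofFn q).prod v = v := by
  induction r with
  | zero => simp
  | succ r ih =>
    rw [List.ofFn_succ, List.prod_cons, Module.End.mul_apply, ih _ fun i => h i.succ, h]

/-- For `u` in the range of `q y'`, the squared norms of the `q z u` sum to that of `u`, which the
term `z = y'` already exhausts. -/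
theorem mul_eq_zero_of_sum_eq_one {Y : Type*} [Fintype Y] {q : Y → Module.End 𝕜 H}
    (hq : ∀ y, (q y).IsSymmetricProjection) (hsum : ∑ y, q y = 1) {y y' : Y} (hy : y ≠ y') :
    q y * q y' = 0 := by
  classical
  have hidem : ∀ z w, q z (q z w) = q z w := fun z w => LinearMap.congr_fun (hq z).1 w
  ext w
  set u := q y' w with hu
  have hnorm : ∀ z, RCLike.re (inner 𝕜 (q z u) u) = ‖q z u‖ ^ 2 := by
    intro z
    rw [norm_sq_eq_re_inner (𝕜 := 𝕜), ← (hq z).2 (q z u) u, hidem]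
  have hsum' : ∑ z, ‖q z u‖ ^ 2 = ‖u‖ ^ 2 := by
    rw [← Finset.sum_congr rfl fun z _ => hnorm z, ← map_sum, ← sum_inner, ← LinearMap.sum_apply,
      hsum, Module.End.one_apply, norm_sq_eq_re_inner (𝕜 := 𝕜)]
  rw [← Finset.add_sum_erase _ _ (Finset.mem_univ y'), hidem y' w, ← hu, add_eq_left,
    Finset.sum_eq_zero_iff_of_nonneg fun _ _ => by positivity] at hsum'
  simpa using hsum' y (Finset.mem_erase.2 ⟨hy, Finset.mem_univ _⟩)

/-- The fixed space of `p` is proper, hence at most a line. Commutation makes `q` preserve it, and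
an idempotent has eigenvalues 0 and 1 only. -/
theorem apply_eq_self_or_eq_zero_of_commute [FiniteDimensional 𝕜 H]
    (hdim : Module.finrank 𝕜 H ≤ 2) {p q : Module.End 𝕜 H} (hp : p ≠ 1) (hq : q * q = q)
    (hpq : p * q = q * p) {v : H} (hv : v ≠ 0) (hpv : p v = v) : q v = v ∨ q v = 0 := by
  have hlt : Module.finrank 𝕜 (LinearMap.eqLocus p (1 : Module.End 𝕜 H)) < Module.finrank 𝕜 H := by
    refine Submodule.finrank_lt fun h => hp ?_
    rwa [LinearMap.eqLocus_eq_top] at h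
  have hqv : p (q v) = q v := by
    rw [← Module.End.mul_apply, hpq, Module.End.mul_apply, hpv]
  have hle : Module.finrank 𝕜 (LinearMap.eqLocus p (1 : Module.End 𝕜 H)) ≤ 1 := by omega
  obtain ⟨w, hw⟩ := finrank_le_one_iff.1 hle
  obtain ⟨a, ha⟩ := hw ⟨v, hpv⟩
  obtain ⟨b, hb⟩ := hw ⟨q v, hqv⟩
  have ha' : a • (w : H) = v := congrArg Subtype.val ha
  have hb' : b • (w : H) = q v := congrArg Subtype.val hb
  have ha0 : a ≠ 0 := by
    rintro rfl
    exact hv (by rw [← ha', zero_smul])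
  have hc : q v = (b * a⁻¹) • v := by
    rw [← hb', ← ha', smul_smul, mul_assoc, inv_mul_cancel₀ ha0, mul_one]
  set c := b * a⁻¹
  have hcc : c • c • v = c • v := by
    have := LinearMap.congr_fun hq v
    rw [Module.End.mul_apply, hc, map_smul, hc] at this
    exact this
  by_cases h0 : c = 0
  · right
    rw [hc, h0, zero_smul]
  · left
    rw [hc]
    exact smul_right_injective H h0 hcc

theorem apply_eq_self_or_eq_zero [FiniteDimensional 𝕜 H]
    (hdim : Module.finrank 𝕜 H ≤ 2) {p q : Module.End 𝕜 H} (hp0 : p ≠ 0) (hp1 : p ≠ 1)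
    (hq : q * q = q) (hpq : p * q = q * p) {v : H} (hv : v ≠ 0) (hpv : p v = v ∨ p v = 0) :
    q v = v ∨ q v = 0 := by
  rcases hpv with hpv | hpv
  · exact apply_eq_self_or_eq_zero_of_commute hdim hp1 hq hpq hv hpv
  · refine apply_eq_self_or_eq_zero_of_commute (p := 1 - p) hdim ?_ hq ?_ hv ?_
    · simpa using hp0
    · rw [sub_mul, mul_sub, hpq, one_mul, mul_one]
    · simp [hpv]

/-- In dimension at most two, a quantum homomorphism yields a homomorphism: choose a common
eigenvector for each maximal commutative algebra of operators. -/
theorem IsQuantumHom.nonempty_hom {L : Language} [L.IsRelational] {X Y : Type*} [L.Structure X]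
    [L.Structure Y] [Fintype Y] [FiniteDimensional 𝕜 H] [Nontrivial H]
    (hdim : Module.finrank 𝕜 H ≤ 2) {p : X → Y → Module.End 𝕜 H} (hp : IsQuantumHom L p) :
    Nonempty (X →[L] Y) := by
  classical
  have hidem : ∀ x y, p x y * p x y = p x y := fun x y => (hp.isProj x y).1
  let triv : X → Prop := fun x => ∀ y, p x y = 0 ∨ p x y = 1
  let E : X → Set H := fun x => {v | v ≠ 0 ∧ ∀ y, p x y v = v ∨ p x y v = 0}
  have hsub : ∀ x x', ¬ triv x → (∀ y y', p x y * p x' y' = p x' y' * p x y) → E x ⊆ E x' := by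
    intro x x' hx hcomm v hv
    simp only [triv, not_forall, not_or] at hx
    obtain ⟨y, hy0, hy1⟩ := hx
    exact ⟨hv.1, fun y' => apply_eq_self_or_eq_zero hdim hy0 hy1 (hidem x' y') (hcomm y y') hv.1
      (hv.2 y)⟩
  have hne : ∀ x, (E x).Nonempty := by
    intro x
    by_cases hx : triv x
    · obtain ⟨v, hv⟩ := exists_ne (0 : H)
      exact ⟨v, hv, fun y => (hx y).elim (fun h => Or.inr (by simp [h]))
        fun h => Or.inl (by simp [h])⟩
    · simp only [triv, not_forall, not_or] at hx
      obtain ⟨y, hy0, hy1⟩ := hx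
      obtain ⟨w, hw⟩ : ∃ w, p x y w ≠ 0 := by
        by_contra! h
        exact hy0 (LinearMap.ext h)
      refine ⟨p x y w, hw, fun y' => apply_eq_self_or_eq_zero hdim hy0 hy1 (hidem x y') ?_ hw
        (Or.inl (LinearMap.congr_fun (hidem x y) w))⟩
      by_cases hyy : y = y'
      · rw [hyy]
      · rw [mul_eq_zero_of_sum_eq_one (hp.isProj x) (hp.sum_eq_one x) hyy,
          mul_eq_zero_of_sum_eq_one (hp.isProj x) (hp.sum_eq_one x) (Ne.symm hyy)]
  -- Choosing from the set, not from `x`, gives the same vector whenever two eigenvector sets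
  -- coincide.
  let pick : Set H → H := fun S => if h : S.Nonempty then h.some else 0
  have hpick : ∀ x, pick (E x) ∈ E x := fun x => by
    simp only [pick, dif_pos (hne x)]
    exact (hne x).some_mem
  have hval : ∀ x, ∃ y, p x y (pick (E x)) = pick (E x) := by
    intro x
    by_contra! h
    refine (hpick x).1 ?_
    calc pick (E x) = (∑ y, p x y) (pick (E x)) := by rw [hp.sum_eq_one, Module.End.one_apply]
      _ = 0 := by
        rw [LinearMap.sum_apply]
        exact Finset.sum_eq_zero fun y _ => ((hpick x).2 y).resolve_left (h y)
  choose g hg using hval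
  have htriv : ∀ x, triv x → p x (g x) = 1 := fun x hx =>
    (hx (g x)).resolve_left fun h => (hpick x).1 (by rw [← hg, h, LinearMap.zero_apply])
  refine ⟨⟨g, fun f => isEmptyElim f, fun {n} R x hx => ?_⟩⟩
  by_contra hR
  obtain ⟨v, hv0, hv⟩ : ∃ v : H, v ≠ 0 ∧ ∀ i, p (x i) (g (x i)) v = v := by
    -- Nontrivial entries share their picked vector; the projectors selected at trivial entries are
    -- 1 and fix anything.
    by_cases hall : ∀ i, triv (x i)
    · obtain ⟨v, hv⟩ := exists_ne (0 : H)
      exact ⟨v, hv, fun i => by rw [htriv _ (hall i), Module.End.one_apply]⟩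
    · push Not at hall
      obtain ⟨i₀, hi₀⟩ := hall
      refine ⟨pick (E (x i₀)), (hpick _).1, fun i => ?_⟩
      by_cases hi : triv (x i)
      · rw [htriv _ hi, Module.End.one_apply]
      · rw [(hsub _ _ hi₀ (hp.commute R x hx i₀ i)).antisymm
          (hsub _ _ hi (hp.commute R x hx i i₀))]
        exact hg _
  refine hv0 ?_
  rw [← prod_ofFn_apply_eq_self (fun i => p (x i) (g (x i))) hv]
  exact LinearMap.congr_fun (hp.prod_eq_zero R x (g ∘ x) hx hR) v

end LowDimension

/-! ### No advantage from the semidefinite minion. -/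

section SemidefiniteMinion

variable {𝕜 H : Type*} [RCLike 𝕜] [NormedAddCommGroup H] [InnerProductSpace 𝕜 H]

/-- Restricting scalars makes `H` a real Euclidean space under the real part of the inner product,
so complex `H` also yields real matrices. -/
theorem exists_real_coordinates [FiniteDimensional 𝕜 H] :
    ∃ (d : ℕ) (φ : H →+ (Fin d → ℝ)), ∀ u v, φ u ⬝ᵥ φ v = RCLike.re (inner 𝕜 u v) := by
  let _ := InnerProductSpace.rclikeToReal 𝕜 H
  have : IsScalarTower ℝ 𝕜 H := RestrictScalars.isScalarTower ℝ 𝕜 H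
  have : FiniteDimensional ℝ H := FiniteDimensional.trans ℝ 𝕜 H
  let b := stdOrthonormalBasis ℝ H
  refine ⟨_, AddMonoidHom.mk' (fun u => (b.repr u).ofLp) fun u v => by
    rw [map_add]; rfl, fun u v => ?_⟩
  have := b.repr.inner_map_map v u
  rw [PiLp.inner_apply] at this
  rw [inner_re_symm, ← real_inner_eq_re_inner, ← this]
  simp [dotProduct]

/-- The matrix whose rows are the coordinates of pairwise orthogonal vectors with sum a unit
vector, as an element of the minion. -/
def sdpOf {d k : ℕ} {φ : H →+ (Fin d → ℝ)}
    (hφ : ∀ u v, φ u ⬝ᵥ φ v = RCLike.re (inner 𝕜 u v)) (w : Fin k → H)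
    (hw : ∀ i j, i ≠ j → inner 𝕜 (w i) (w j) = 0) (h1 : ‖∑ i, w i‖ = 1) :
    Σ d : ℕ, {M : Matrix (Fin k) (Fin d) ℝ // IsSDPMatrix M} :=
  ⟨d, Matrix.of fun i => φ (w i), by
    have hmul : ∀ i j, ((Matrix.of fun i => φ (w i)) * (Matrix.of fun i => φ (w i)).transpose) i j =
        RCLike.re (inner 𝕜 (w i) (w j)) := fun i j => hφ _ _
    refine ⟨fun i j hij => ?_, ?_⟩
    · exact (hmul i j).trans (by rw [hw i j hij, map_zero])
    · simp only [Matrix.trace, Matrix.diag_apply, hmul]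
      rw [← one_pow 2, ← h1, norm_sq_eq_re_inner (𝕜 := 𝕜), sum_inner, map_sum]
      refine Finset.sum_congr rfl fun i _ => ?_
      rw [inner_sum, Finset.sum_eq_single i fun j _ hj => hw i j hj.symm]
      simp⟩

theorem minor_sdpOf {d : ℕ} {k l : ℕ+} {φ : H →+ (Fin d → ℝ)}
    (hφ : ∀ u v, φ u ⬝ᵥ φ v = RCLike.re (inner 𝕜 u v)) {w : Fin k → H}
    (hw : ∀ i j, i ≠ j → inner 𝕜 (w i) (w j) = 0) (h1 : ‖∑ i, w i‖ = 1) {w' : Fin l → H}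
    (hw' : ∀ i j, i ≠ j → inner 𝕜 (w' i) (w' j) = 0) (h1' : ‖∑ i, w' i‖ = 1)
    {π : Fin k → Fin l} (hπ : ∀ i, ∑ j with π j = i, w j = w' i) :
    sdpMinion.minor π (sdpOf hφ w hw h1) = sdpOf hφ w' hw' h1' := by
  refine congrArg (Sigma.mk d) (Subtype.ext ?_)
  funext i
  change ∑ j with π j = i, φ (w j) = φ (w' i)
  rw [← map_sum, hπ]

theorem sum_prod_ofFn {r : ℕ} {Y : Type*} [Fintype Y] (q : Fin r → Y → Module.End 𝕜 H) :
    ∑ t : Fin r → Y, (List.ofFn fun i => q i (t i)).prod =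
      (List.ofFn fun i => ∑ y, q i y).prod := by
  induction r with
  | zero => simp
  | succ r ih =>
    rw [← (Fin.consEquiv fun _ : Fin (r + 1) => Y).sum_comp, Fintype.sum_prod_type]
    simp only [List.ofFn_succ, List.prod_cons, Fin.consEquiv_apply, Fin.cons_zero, Fin.cons_succ]
    rw [← ih, Finset.sum_mul]
    simp only [Finset.mul_sum]

theorem mul_prod_of_mem {M : Type*} [Monoid M] {a : M} (ha : a * a = a) {l : List M} (hl : a ∈ l)
    (hcomm : ∀ b ∈ l, a * b = b * a) : a * l.prod = l.prod := by
  induction l with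
  | nil => simp at hl
  | cons b l ih =>
    rw [List.prod_cons]
    rcases List.mem_cons.1 hl with rfl | hl
    · rw [← mul_assoc, ha]
    · rw [← mul_assoc, hcomm b List.mem_cons_self, mul_assoc,
        ih hl fun c hc => hcomm c (List.mem_cons_of_mem _ hc)]

namespace IsQuantumHom

variable {L : Language} {X Y : Type*} [L.Structure X] [L.Structure Y] [Fintype Y]
  {p : X → Y → Module.End 𝕜 H}

theorem mul_eq_zero (hp : IsQuantumHom L p) (x : X) {y y' : Y} (hy : y ≠ y') :
    p x y * p x y' = 0 :=
  mul_eq_zero_of_sum_eq_one (hp.isProj x) (hp.sum_eq_one x) hy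

theorem inner_apply_eq_zero (hp : IsQuantumHom L p) (x : X) {y y' : Y} (hy : y ≠ y') (u v : H) :
    inner 𝕜 (p x y u) (p x y' v) = 0 := by
  rw [(hp.isProj x y).2, ← Module.End.mul_apply, hp.mul_eq_zero x hy, LinearMap.zero_apply,
    inner_zero_right]

section Tuple

variable {r : ℕ} {R : L.Relations r} {x : Fin r → X}

theorem mul_prod (hp : IsQuantumHom L p) (hx : Structure.RelMap R x) (t : Fin r → Y) (i : Fin r) :
    p (x i) (t i) * (List.ofFn fun j => p (x j) (t j)).prod =
      (List.ofFn fun j => p (x j) (t j)).prod := by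
  refine mul_prod_of_mem (hp.isProj _ _).1 ((List.mem_ofFn' _ _).2 ⟨i, rfl⟩) fun b hb => ?_
  obtain ⟨j, rfl⟩ := (List.mem_ofFn' _ _).1 hb
  exact hp.commute R x hx _ _ _ _

theorem inner_prod_eq_zero (hp : IsQuantumHom L p) (hx : Structure.RelMap R x) {t t' : Fin r → Y}
    (h : t ≠ t') (u v : H) :
    inner 𝕜 ((List.ofFn fun j => p (x j) (t j)).prod u)
      ((List.ofFn fun j => p (x j) (t' j)).prod v) = 0 := by
  obtain ⟨i, hi⟩ := Function.ne_iff.1 h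
  rw [← hp.mul_prod hx t i, ← hp.mul_prod hx t' i]
  exact hp.inner_apply_eq_zero _ hi _ _

-- Expand the identity as the sum of the products over all tuples. Multiplying by `p (x i) y` keeps
-- those with `i`-th entry `y`, and those outside `R` vanish.
open scoped Classical in
theorem sum_prod_fiber (hp : IsQuantumHom L p) (hx : Structure.RelMap R x) (i : Fin r) (y : Y) :
    ∑ t : {t : Fin r → Y // Structure.RelMap R t} with t.1 i = y,
      (List.ofFn fun j => p (x j) (t.1 j)).prod = p (x i) y := by
  have hone : ∑ t : Fin r → Y, (List.ofFn fun j => p (x j) (t j)).prod = 1 := by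
    rw [sum_prod_ofFn]
    simp [hp.sum_eq_one]
  have hterm : ∀ t : Fin r → Y, p (x i) y * (List.ofFn fun j => p (x j) (t j)).prod =
      if t i = y then (List.ofFn fun j => p (x j) (t j)).prod else 0 := by
    intro t
    split_ifs with h
    · rw [← h, hp.mul_prod hx]
    · rw [← hp.mul_prod hx t i, ← mul_assoc, hp.mul_eq_zero _ (Ne.symm h), zero_mul]
  rw [← mul_one (p (x i) y), ← hone, Finset.mul_sum, Finset.sum_congr rfl fun t _ => hterm t,
    Finset.sum_filter]
  rw [← Fintype.sum_subtype_add_sum_subtype fun t : Fin r → Y => Structure.RelMap R t, left_eq_add]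
  refine Finset.sum_eq_zero fun t _ => ?_
  rw [hp.prod_eq_zero R x t.1 hx t.2, ite_self]

end Tuple

/-- A minion homomorphism from the semidefinite minion turns quantum homomorphisms to `Y` into
homomorphisms to `Y'`. -/
theorem nonempty_hom_of_sdp [L.IsRelational] [IsEmpty (L.Relations 0)] {Y' : Type*}
    [L.Structure Y'] [FiniteDimensional 𝕜 H] [Nontrivial H] {h : Nonempty (Y →[L] Y')}
    (ξ : MinionHom sdpMinion (polMinion L Y Y' h)) (hp : IsQuantumHom L p) :
    Nonempty (X →[L] Y') := by
  classical
  cases isEmpty_or_nonempty X with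
  | inl hX =>
    refine ⟨⟨isEmptyElim, fun f => isEmptyElim f, fun {n} R x _ => ?_⟩⟩
    cases n with
    | zero => exact isEmptyElim R
    | succ n => exact isEmptyElim (x 0)
  | inr hX =>
    have hY : Nonempty Y := by
      by_contra hY
      rw [not_nonempty_iff] at hY
      have := hp.sum_eq_one hX.some
      rw [Finset.univ_eq_empty, Finset.sum_empty] at this
      exact zero_ne_one this
    obtain ⟨d, φ, hφ⟩ := exists_real_coordinates (𝕜 := 𝕜) (H := H)
    obtain ⟨v, hv⟩ : ∃ v : H, ‖v‖ = 1 := by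
      obtain ⟨z, hz⟩ := exists_ne (0 : H)
      exact ⟨_, norm_smul_inv_norm (𝕜 := 𝕜) hz⟩
    let m : ℕ+ := ⟨Fintype.card Y, Fintype.card_pos⟩
    let eY : Y ≃ Fin m := Fintype.equivFin Y
    -- Evaluating at the tuple that enumerates `Y` turns a minor along a map into `Y` into the value
    -- at that map.
    let e : DirectPower Y m := fun k => eY.symm k
    let w : X → Fin m → H := fun x k => p x (eY.symm k) v
    have hw : ∀ x i j, i ≠ j → inner 𝕜 (w x i) (w x j) = 0 := fun x i j hij =>
      hp.inner_apply_eq_zero x (eY.symm.injective.ne hij) v v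
    have hw1 : ∀ x, ∑ k, w x k = v := fun x => by
      rw [eY.symm.sum_comp fun y => p x y v, ← LinearMap.sum_apply, hp.sum_eq_one,
        Module.End.one_apply]
    let f : X → (polMinion L Y Y' h).obj m := fun x =>
      ξ.toFun (ℓ := m) (sdpOf hφ (w x) (hw x) (by rw [hw1, hv]))
    let f' : X → DirectPower Y m →[L] Y' := f
    refine ⟨⟨fun x => f' x e, fun g => isEmptyElim g, fun {r} R x hx => ?_⟩⟩
    let K := {t : Fin r → Y // Structure.RelMap R t}
    let u : K → H := fun t => (List.ofFn fun j => p (x j) (t.1 j)).prod v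
    have hfib : ∀ i y, ∑ t : K with t.1 i = y, u t = p (x i) y v := fun i y => by
      rw [← hp.sum_prod_fiber hx i y, LinearMap.sum_apply]
    -- Positive arity provides a coordinate along which to group the tuples.
    have hr : 0 < r := Nat.pos_of_ne_zero (by rintro rfl; exact isEmptyElim R)
    have hu1 : ∑ t, u t = v := by
      rw [← Finset.sum_fiberwise Finset.univ (fun t : K => t.1 ⟨0, hr⟩) u]
      simp only [hfib]
      rw [← LinearMap.sum_apply, hp.sum_eq_one, Module.End.one_apply]
    have hK : Nonempty K := by
      by_contra hK
      rw [not_nonempty_iff] at hK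
      rw [Finset.univ_eq_empty, Finset.sum_empty] at hu1
      rw [← hu1, norm_zero] at hv
      exact zero_ne_one hv
    let l : ℕ+ := ⟨Fintype.card K, Fintype.card_pos⟩
    let eK : K ≃ Fin l := Fintype.equivFin K
    have hu : ∀ i j, i ≠ j → inner 𝕜 (u (eK.symm i)) (u (eK.symm j)) = 0 := fun i j hij =>
      hp.inner_prod_eq_zero hx (fun h => hij (eK.symm.injective (Subtype.ext h))) v v
    let N : sdpMinion.obj l := sdpOf hφ (fun k => u (eK.symm k)) hu
      (by rw [eK.symm.sum_comp u, hu1, hv])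
    let F : DirectPower Y l →[L] Y' := ξ.toFun (ℓ := l) N
    have hF : ∀ i, f' (x i) = polMinor (fun k => eY ((eK.symm k).1 i)) F := by
      intro i
      have hminor : sdpMinion.minor (ℓ := l) (ℓ' := m) (fun k => eY ((eK.symm k).1 i)) N =
          sdpOf hφ (w (x i)) (hw (x i)) (by rw [hw1, hv]) := by
        refine minor_sdpOf hφ _ _ _ _ fun k => ?_
        refine Eq.trans ?_ (hfib i (eY.symm k))
        refine Finset.sum_equiv eK.symm (fun j => ?_) fun _ _ => rfl
        simp [Equiv.eq_symm_apply]
      exact (congrArg ξ.toFun hminor).symm.trans (ξ.map_minor _ N)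
    have hval : ∀ i, f' (x i) e = F fun k => (eK.symm k).1 i := fun i => by
      rw [hF]
      refine congrArg F (funext fun k => ?_)
      exact eY.symm_apply_apply _
    change Structure.RelMap R fun i => f' (x i) e
    -- The `k`-th coordinates of the arguments of `F` now form the `k`-th tuple of `R` in `Y`, so
    -- `F` preserves the relation.
    simp only [hval]
    exact F.map_rel R (fun i k => (eK.symm k).1 i) fun k => (eK.symm k).2

end IsQuantumHom

end SemidefiniteMinion

end QuantumPCSP

theorem mainTheorem9
    (L : FirstOrder.Language) [L.IsRelational] [Finite L.Symbols] [IsEmpty (L.Relations 0)]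
    (Y Y' : Type*) [Fintype Y] [Finite Y'] [L.Structure Y] [L.Structure Y']
    (h : Nonempty (Y →[L] Y')) :
    (∀ (𝕜 H : Type*) [RCLike 𝕜] [NormedAddCommGroup H] [InnerProductSpace 𝕜 H]
      [FiniteDimensional 𝕜 H] [Nontrivial H],
      Module.finrank 𝕜 H ≤ 2 → ¬ QuantumPCSP.HasQuantumAdvantage L Y Y' 𝕜 H) ∧
    (∀ (𝕜 H : Type*) [RCLike 𝕜] [NormedAddCommGroup H] [InnerProductSpace 𝕜 H]
      [FiniteDimensional 𝕜 H] [Nontrivial H],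
      3 ≤ Module.finrank 𝕜 H →
      Nonempty (QuantumPCSP.MinionHom (QuantumPCSP.polMinion L Y Y' h)
        QuantumPCSP.dictatorMinion) →
      QuantumPCSP.HasQuantumAdvantage L Y Y' 𝕜 H) ∧
    (Nonempty (QuantumPCSP.MinionHom QuantumPCSP.sdpMinion (QuantumPCSP.polMinion L Y Y' h)) →
      ∀ (𝕜 H : Type*) [RCLike 𝕜] [NormedAddCommGroup H] [InnerProductSpace 𝕜 H]
        [FiniteDimensional 𝕜 H] [Nontrivial H],
        ¬ QuantumPCSP.HasQuantumAdvantage L Y Y' 𝕜 H) := by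
  refine ⟨?_, ?_, ?_⟩
  · rintro 𝕜 H _ _ _ _ _ hdim ⟨X, _, _, ⟨p, hp⟩, hX⟩
    obtain ⟨f⟩ := h
    obtain ⟨g⟩ := hp.nonempty_hom hdim
    exact hX.false (f.comp g)
  · rintro 𝕜 H _ _ _ _ _ hdim ⟨ξ⟩
    exact QuantumPCSP.hasQuantumAdvantage_of_dictator h ξ hdim
  · rintro ⟨ξ⟩ 𝕜 H _ _ _ _ _ ⟨X, _, _, ⟨p, hp⟩, hX⟩
    obtain ⟨g⟩ := hp.nonempty_hom_of_sdp ξ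
    exact hX.false g
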